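/- Let $k\ge 1$ be an integer and let $G$ be a finite simple graph of order $n$. Write $\rho(G)$ for the spectral radius of $G$, i.e. the largest eigenvalue of its adjacency matrix $A(G)$, and $q(G)$ for its signless Laplacian spectral radius, i.e. the largest eigenvalue of $A(G)+D(G)$, where $D(G)$ is the diagonal matrix of vertex degrees. Let $L_{n,k}=K_1\vee(K_{n-k-1}+K_k)$, where $+$ denotes the disjoint union and $\vee$ the join of graphs. Suppose that either (a) $\rho(G)\ge\rho(L_{n,k})$ and $n\ge\max\left\{6k+11,\frac{(k+3)(k+4)}{2}\right\}$, or (b) $q(G)\ge q(L_{n,k})$ and $n\ge\max\{6k+11,\,k^2+2k+3\}$. Then $G$ contains a cycle $C_\ell$ of length $\ell$ (as a subgraph) for every integer $\ell\in[3,n-k+1]$, unless $G$ is isomorphic to $L_{n,k}$. -/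

import Mathlib

noncomputable section

namespace SpectralCycles

/-- The largest real eigenvalue of a square real matrix. For a symmetric matrix indexed by a
nonempty type this is a genuine maximum, see `isGreatest_largestEigenvalue`. -/
def largestEigenvalue {V : Type*} [Fintype V] [DecidableEq V] (M : Matrix V V ℝ) : ℝ :=
  sSup {μ : ℝ | Module.End.HasEigenvalue (Matrix.toLin' M) μ}

theorem isGreatest_largestEigenvalue {V : Type*} [Fintype V] [DecidableEq V] [Nonempty V]
    {M : Matrix V V ℝ} (hM : M.IsHermitian) :
    IsGreatest {μ : ℝ | Module.End.HasEigenvalue (Matrix.toLin' M) μ} (largestEigenvalue M) := by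
  have h : {μ : ℝ | Module.End.HasEigenvalue (Matrix.toLin' M) μ} = Set.range hM.eigenvalues := by
    rw [← hM.spectrum_real_eq_range_eigenvalues, ← Matrix.spectrum_toLin']
    ext μ
    exact Module.End.hasEigenvalue_iff_mem_spectrum
  unfold largestEigenvalue
  rw [h]
  exact ⟨(Set.range_nonempty _).csSup_mem (Set.finite_range _),
    fun _ hx => le_csSup (Set.finite_range _).bddAbove hx⟩

open Classical in
/-- The spectral radius `ρ(G)`: the largest eigenvalue of the adjacency matrix `A(G)`. -/
def rho {V : Type*} [Fintype V] (G : SimpleGraph V) : ℝ :=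
  largestEigenvalue (G.adjMatrix ℝ)

open Classical in
/-- The signless Laplacian spectral radius `q(G)`: the largest eigenvalue of `A(G) + D(G)`. -/
def q {V : Type*} [Fintype V] (G : SimpleGraph V) : ℝ :=
  largestEigenvalue (G.adjMatrix ℝ + G.degMatrix ℝ)

/-- The join `G ∨ H`: the disjoint union together with all edges between the two parts. -/
def join {V W : Type*} (G : SimpleGraph V) (H : SimpleGraph W) : SimpleGraph (V ⊕ W) :=
  SimpleGraph.sum G H ⊔ completeBipartiteGraph V W

/-- The graph `L_{n,k} = K_1 ∨ (K_{n-k-1} + K_k)`; it has order `n` when `k + 1 ≤ n`. -/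
def L (n k : ℕ) : SimpleGraph (Fin 1 ⊕ (Fin (n - k - 1) ⊕ Fin k)) :=
  join (SimpleGraph.completeGraph (Fin 1))
    (SimpleGraph.sum (SimpleGraph.completeGraph (Fin (n - k - 1))) (SimpleGraph.completeGraph (Fin k)))

end SpectralCycles

end

namespace SpectralCycles

open Finset

/-! Put `a = n - k`; then `L n k` consists of a clique on `a` vertices and one on `k + 1` vertices
sharing a vertex. Both radii are the cases `t = 0, 1` of the largest eigenvalue of `A + tD`.

The `a`-clique bounds the radius of `L n k` from below. Stanley's inequality, or
`lt_sum_degIn_of_lt_weightedRadius_one` for `q`, turns this into a degree sum of at least `a² - 3a +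
(k+1)(k+2) + 6` in `G`.

Suppose the length `l ≤ a + 1` is missing. A dense enough set of `a + i` vertices, `1 ≤ i ≤ k`, in
which every degree exceeds `i + 1` would be Hamiltonian by Pósa's theorem, and then pancyclic by
density. So a vertex of small degree can always be deleted, and `k` deletions leave a set `S` of `a`
vertices, almost complete. Adding to `S` a vertex with two neighbours there would again give all
lengths up to `a + 1`; hence every outside vertex has at most one neighbour in `S`
(`exists_subset_degIn_le_one`).

For such graphs, let `h` carry the largest entry in `S` of a nonnegative top eigenvector.
Redirecting all cross edges to `h` and completing both sides does not lower the quadratic form and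
produces `L n k`. Since the radius of `G` is at least that of `L n k`, equality holds throughout,
and this forces `G` to be that graph (`eq_cliquePair_of_weightedRadius_le`). -/

/-- `f 0, …, f (p - 1)` are distinct vertices that form a cycle of `G` in this order. -/
def IsCycleSeq {V : Type*} (G : SimpleGraph V) (p : ℕ) (f : ℕ → V) : Prop :=
  (∀ i < p, ∀ j < p, f i = f j → i = j) ∧
    (∀ i, i + 1 < p → G.Adj (f i) (f (i + 1))) ∧ G.Adj (f (p - 1)) (f 0)

/-! ### Cycles as sequences, and splicing chords into them -/

section
variable {V : Type*} {G : SimpleGraph V}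

theorem IsCycleSeq.isContained {p : ℕ} {f : ℕ → V} (hp : 3 ≤ p) (hf : IsCycleSeq G p f) :
    (SimpleGraph.cycleGraph p).IsContained G := by
  obtain ⟨hinj, hadj, hlast⟩ := hf
  have key : ∀ u v : Fin p, (u - v).val = 1 → G.Adj (f u) (f v) := by
    intro u v h
    have hu := u.isLt
    have hv := v.isLt
    rw [Fin.sub_def] at h
    simp only at h
    by_cases hc : v.val ≤ u.val
    · have h2 : p - v.val + u.val = p + (u.val - v.val) := by omega
      rw [h2, Nat.add_mod_left, Nat.mod_eq_of_lt (by omega)] at h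
      have h3 : u.val = v.val + 1 := by omega
      rw [h3]
      exact (hadj v (by omega)).symm
    · rw [Nat.mod_eq_of_lt (by omega)] at h
      have h3 : v.val = p - 1 := by omega
      have h4 : u.val = 0 := by omega
      rw [h3, h4]
      exact hlast.symm
  refine ⟨⟨⟨fun i => f i, ?_⟩, ?_⟩⟩
  · intro u v h
    rw [SimpleGraph.cycleGraph_adj'] at h
    rcases h with h | h
    · exact key u v h
    · exact (key v u h).symm
  · intro u v h
    exact Fin.ext (hinj u u.isLt v v.isLt h)

theorem IsCycleSeq.rotate {p : ℕ} {f : ℕ → V} (hp : 0 < p) (hf : IsCycleSeq G p f) (a : ℕ) :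
    IsCycleSeq G p (fun t => f ((t + a) % p)) := by
  obtain ⟨hinj, hadj, hlast⟩ := hf
  have step : ∀ m, G.Adj (f (m % p)) (f ((m + 1) % p)) := by
    intro m
    have h1 := Nat.mod_lt m hp
    rw [Nat.add_mod]
    by_cases h : m % p + 1 < p
    · have h1p : 1 % p = 1 := Nat.mod_eq_of_lt (by omega)
      rw [h1p, Nat.mod_eq_of_lt h]
      exact hadj _ h
    · have h2 : m % p = p - 1 := by omega
      by_cases hp1 : p = 1
      · subst hp1
        simp at hlast
      · have h1p : 1 % p = 1 := Nat.mod_eq_of_lt (by omega)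
        rw [h1p, h2, Nat.sub_add_cancel hp, Nat.mod_self]
        exact hlast
  refine ⟨?_, ?_, ?_⟩
  · intro i hi j hj h
    have h1 := hinj _ (Nat.mod_lt _ hp) _ (Nat.mod_lt _ hp) h
    have h2 : i ≡ j [MOD p] := Nat.ModEq.add_right_cancel' a h1
    exact Nat.ModEq.eq_of_lt_of_lt h2 hi hj
  · intro i _
    have := step (i + a)
    simpa [show i + 1 + a = i + a + 1 by omega] using this
  · have := step (p - 1 + a)
    rw [show p - 1 + a + 1 = p + (0 + a) by omega, Nat.add_mod_left] at this
    exact this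

theorem IsCycleSeq.mono {G G' : SimpleGraph V} {p : ℕ} {f : ℕ → V} (h : G ≤ G')
    (hf : IsCycleSeq G p f) : IsCycleSeq G' p f :=
  ⟨hf.1, fun i hi => h (hf.2.1 i hi), h hf.2.2⟩

/-- A cycle that uses a new edge yields a path between the ends of this edge. -/
theorem exists_path_of_isCycleSeq_sup_edge {G : SimpleGraph V} {p : ℕ} {f : ℕ → V} {u v : V}
    (hp : 3 ≤ p) (hf : IsCycleSeq (G ⊔ SimpleGraph.edge u v) p f) (hG : ¬ IsCycleSeq G p f) :
    ∃ g : ℕ → V, (∀ i < p, ∀ j < p, g i = g j → i = j) ∧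
      (∀ i, i + 1 < p → G.Adj (g i) (g (i + 1))) ∧
      ((g 0 = u ∧ g (p - 1) = v) ∨ (g 0 = v ∧ g (p - 1) = u)) := by
  -- Some cyclic step leaves `G`, so it is the new edge; rotation makes it the closing step.
  obtain ⟨i, hi, hnot⟩ : ∃ i < p, ¬ G.Adj (f i) (f ((i + 1) % p)) := by
    by_contra! hcon
    refine hG ⟨hf.1, fun i hi => ?_, ?_⟩
    · have := hcon i (by omega)
      rwa [Nat.mod_eq_of_lt hi] at this
    · have := hcon (p - 1) (by omega)
      rwa [Nat.sub_add_cancel (by omega), Nat.mod_self] at this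
  have hg := hf.rotate (by omega) (i + 1)
  have e1 : f i = f ((p - 1 + (i + 1)) % p) := by
    rw [show p - 1 + (i + 1) = p + i by omega, Nat.add_mod_left, Nat.mod_eq_of_lt hi]
  have e0 : f ((i + 1) % p) = f ((0 + (i + 1)) % p) := by rw [Nat.zero_add]
  rw [e1, e0] at hnot
  clear e0 e1
  change ¬ G.Adj ((fun t => f ((t + (i + 1)) % p)) (p - 1)) ((fun t => f ((t + (i + 1)) % p)) 0)
    at hnot
  generalize (fun t => f ((t + (i + 1)) % p)) = g at hg hnot
  obtain ⟨hinj, hadj, hlast⟩ := hg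
  simp only [SimpleGraph.sup_adj, SimpleGraph.edge_adj] at hadj hlast
  have hends : (g 0 = u ∧ g (p - 1) = v) ∨ (g 0 = v ∧ g (p - 1) = u) := by tauto
  refine ⟨g, hinj, fun t ht => ?_, hends⟩
  rcases hadj t ht with h | ⟨h, -⟩
  · exact h
  exfalso
  -- A second use of the new edge would make positions `0` and `p - 1` consecutive, against `3 ≤ p`.
  have key : ∀ s < p, g s = u ∨ g s = v → s = 0 ∨ s = p - 1 := by
    intro s hs h
    rcases hends with ⟨h0, h1⟩ | ⟨h0, h1⟩ <;> rcases h with h | h <;>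
      first
      | exact Or.inl (hinj s hs 0 (by omega) (h.trans h0.symm))
      | exact Or.inr (hinj s hs (p - 1) (by omega) (h.trans h1.symm))
  have k1 := key t (by omega) (by tauto)
  have k2 := key (t + 1) ht (by tauto)
  omega

/-- Two chords from the ends of a spanning path close it to a cycle. -/
theorem isCycleSeq_of_crossing {p i : ℕ} {f : ℕ → V}
    (hinj : ∀ i < p, ∀ j < p, f i = f j → i = j)
    (hadj : ∀ i, i + 1 < p → G.Adj (f i) (f (i + 1))) (hi : i + 1 < p)
    (h0 : G.Adj (f 0) (f (i + 1))) (h1 : G.Adj (f i) (f (p - 1))) :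
    IsCycleSeq G p (fun t => if t ≤ i then f t else f (p + i - t)) := by
  refine ⟨?_, ?_, ?_⟩
  · intro a ha b hb h
    simp only at h
    split_ifs at h <;> have := hinj _ (by omega) _ (by omega) h <;> omega
  · intro t ht
    simp only
    split_ifs with c1 c2 c2
    · exact hadj t ht
    · have : t = i := by omega
      subst this
      rw [show p + t - (t + 1) = p - 1 by omega]
      exact h1
    · omega
    · have := (hadj (p + i - (t + 1)) (by omega)).symm
      rwa [show p + i - (t + 1) + 1 = p + i - t by omega] at this
  · have c : ¬ (p - 1 ≤ i) := by omega
    simp only [c, if_false, Nat.zero_le, if_true]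
    rw [show p + i - (p - 1) = i + 1 by omega]
    exact h0.symm

/-- Two chords at a common distance, from consecutive vertices of a cycle. -/
theorem isCycleSeq_of_parallel {p j l : ℕ} {f : ℕ → V} (hf : IsCycleSeq G p f)
    (hl : 3 ≤ l) (hj : 1 ≤ j) (hjl : j + l ≤ p + 1)
    (h0 : G.Adj (f 0) (f j)) (h1 : G.Adj (f (j + l - 3)) (f (p - 1))) :
    IsCycleSeq G l
      (fun t => if t = 0 then f 0 else if t = l - 1 then f (p - 1) else f (j + t - 1)) := by
  obtain ⟨hinj, hadj, hlast⟩ := hf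
  refine ⟨?_, ?_, ?_⟩
  · intro a ha b hb h
    simp only at h
    split_ifs at h <;> first | omega | (have := hinj _ (by omega) _ (by omega) h; omega)
  · intro t ht
    have c3 : t + 1 ≠ 0 := by omega
    have c4 : t ≠ l - 1 := by omega
    simp only [c3, c4, if_false]
    split_ifs with c1 c2 c2
    · omega
    · subst c1
      simpa using h0
    · rw [show j + t - 1 = j + l - 3 by omega]
      exact h1
    · have := hadj (j + t - 1) (by omega)
      rwa [show j + t - 1 + 1 = j + (t + 1) - 1 by omega] at this
  · have c : l - 1 ≠ 0 := by omega
    simp only [c, if_false, if_true]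
    exact hlast

/-- Two crossing chords from consecutive vertices of a cycle. -/
theorem isCycleSeq_of_crossing_shortcut {p i j l : ℕ} {f : ℕ → V} (hf : IsCycleSeq G p f)
    (hl : l ≤ p) (hi : i + p + 1 = j + l) (hj : j + 1 < p)
    (h0 : G.Adj (f 0) (f j)) (h1 : G.Adj (f i) (f (p - 1))) :
    IsCycleSeq G l (fun t => if t ≤ i then f t else f (p + i - t)) := by
  obtain ⟨hinj, hadj, hlast⟩ := hf
  refine ⟨?_, ?_, ?_⟩
  · intro a ha b hb h
    simp only at h
    split_ifs at h <;> have := hinj _ (by omega) _ (by omega) h <;> omega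
  · intro t ht
    simp only
    split_ifs with c1 c2 c2
    · exact hadj t (by omega)
    · have : t = i := by omega
      subst this
      rw [show p + t - (t + 1) = p - 1 by omega]
      exact h1
    · omega
    · have := (hadj (p + i - (t + 1)) (by omega)).symm
      rwa [show p + i - (t + 1) + 1 = p + i - t by omega] at this
  · have c : ¬ (l - 1 ≤ i) := by omega
    simp only [c, if_false, Nat.zero_le, if_true]
    rw [show p + i - (l - 1) = j by omega]
    exact h0.symm

end

/-! ### Pancyclicity from a spanning cycle, and Pósa's theorem -/

section
variable {V : Type*} [Fintype V]

theorem exists_lt_eq_of_injective_seq {p : ℕ} {f : ℕ → V} (hp : Fintype.card V = p)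
    (hinj : ∀ i < p, ∀ j < p, f i = f j → i = j) (v : V) : ∃ i < p, f i = v := by
  classical
  have h : (range p).image f = univ := by
    apply Finset.eq_univ_of_card
    rw [card_image_of_injOn, card_range, hp]
    intro i hi j hj h
    exact hinj i (by simpa using hi) j (by simpa using hj) h
  have := h ▸ mem_univ v
  simpa using this

theorem sum_range_comp_eq {p : ℕ} {f : ℕ → V} (hp : Fintype.card V = p)
    (hinj : ∀ i < p, ∀ j < p, f i = f j → i = j) (F : V → ℕ) :
    ∑ i ∈ range p, F (f i) = ∑ v, F v := by
  refine sum_bij (fun i _ => f i) (fun _ _ => mem_univ _) ?_ ?_ (fun _ _ => rfl)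
  · intro i hi j hj h
    exact hinj i (by simpa using hi) j (by simpa using hj) h
  · intro v _
    obtain ⟨i, hi, h⟩ := exists_lt_eq_of_injective_seq hp hinj v
    exact ⟨i, by simpa using hi, h⟩

open Classical in
theorem degree_eq_card_filter {G : SimpleGraph V} {p : ℕ} {f : ℕ → V} (hp : Fintype.card V = p)
    (hinj : ∀ i < p, ∀ j < p, f i = f j → i = j) (v : V) :
    G.degree v = #{i ∈ range p | G.Adj v (f i)} := by
  rw [card_filter, sum_range_comp_eq hp hinj (fun w => if G.Adj v w then 1 else 0),
    ← card_filter, ← SimpleGraph.card_neighborFinset_eq_degree, SimpleGraph.neighborFinset_eq_filter]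

open Classical in
/-- If a cycle through all vertices exists and the degree sum exceeds `p ^ 2 / 2`, then the graph
is pancyclic. -/
theorem exists_isCycleSeq_of_spanning {G : SimpleGraph V} {p : ℕ} {f : ℕ → V}
    (hp : Fintype.card V = p) (hf : IsCycleSeq G p f) (hd : p ^ 2 < 2 * ∑ v, G.degree v)
    {l : ℕ} (hl : 3 ≤ l) (hlp : l ≤ p) : ∃ g, IsCycleSeq G l g := by
  have hp0 : 0 < p := by omega
  -- Averaging over the `p` steps of the cycle: each degree is counted twice.
  obtain ⟨i, hi, hdi⟩ : ∃ i ∈ range p, p < G.degree (f i) + G.degree (f ((i + 1) % p)) := by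
    by_contra! hcon
    have h1 := sum_le_sum hcon
    rw [sum_add_distrib, sum_range_comp_eq hp hf.1 (G.degree ·),
      sum_range_comp_eq (f := fun i => f ((i + 1) % p)) hp (hf.rotate hp0 1).1 (G.degree ·)] at h1
    simp only [sum_const, card_range, smul_eq_mul] at h1
    nlinarith
  rw [mem_range] at hi
  have hg := hf.rotate hp0 (i + 1)
  have e1 : f ((p - 1 + (i + 1)) % p) = f i := by
    rw [show p - 1 + (i + 1) = p + i by omega, Nat.add_mod_left, Nat.mod_eq_of_lt hi]
  have e0 : f ((i + 1) % p) = f ((0 + (i + 1)) % p) := by rw [Nat.zero_add]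
  rw [← e1, e0] at hdi
  clear e0 e1
  change p < G.degree ((fun t => f ((t + (i + 1)) % p)) (p - 1)) +
    G.degree ((fun t => f ((t + (i + 1)) % p)) 0) at hdi
  generalize (fun t => f ((t + (i + 1)) % p)) = g at hg hdi
  have hdeg : ∀ v, G.degree v ≤ #{j ∈ Ico 1 (p - 1) | G.Adj v (g j)} +
      #{j ∈ ({0, p - 1} : Finset ℕ) | G.Adj v (g j)} := by
    intro v
    rw [degree_eq_card_filter hp hg.1]
    refine (card_le_card ?_).trans (card_union_le _ _)
    intro j
    simp only [mem_filter, mem_range, mem_union, mem_Ico, mem_insert, mem_singleton]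
    rintro ⟨hj, hj'⟩
    have : (1 ≤ j ∧ j < p - 1) ∨ (j = 0 ∨ j = p - 1) := by omega
    tauto
  have hA := hdeg (g 0)
  have hB := hdeg (g (p - 1))
  have hA' : #{j ∈ ({0, p - 1} : Finset ℕ) | G.Adj (g 0) (g j)} ≤ 1 := by
    refine (card_le_card (t := {p - 1}) ?_).trans (card_singleton _).le
    intro j
    simp only [mem_filter, mem_insert, mem_singleton]
    rintro ⟨rfl | h, hj⟩
    · exact absurd hj (G.irrefl)
    · exact h
  have hB' : #{j ∈ ({0, p - 1} : Finset ℕ) | G.Adj (g (p - 1)) (g j)} ≤ 1 := by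
    refine (card_le_card (t := {0}) ?_).trans (card_singleton _).le
    intro j
    simp only [mem_filter, mem_insert, mem_singleton]
    rintro ⟨h | rfl, hj⟩
    · exact h
    · exact absurd hj (G.irrefl)
  set A := {j ∈ Ico 1 (p - 1) | G.Adj (g 0) (g j)} with hAdef
  set B := {j ∈ Ico 1 (p - 1) | G.Adj (g (p - 1)) (g j)} with hBdef
  -- The cyclic shift by `l - 3` on `1, …, p - 2`. Chords from `g 0` to `g j` and from `g (p - 1)`
  -- to `g (σ j)` close a cycle of length `l`: parallel chords before the wrap-around, crossing ones
  -- after it.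
  let σ : ℕ → ℕ := fun j => if j + l ≤ p + 1 then j + l - 3 else j + l - 1 - p
  have hσ : Set.InjOn σ A := by
    intro x hx y hy h
    simp only [hAdef, coe_filter, mem_Ico, Set.mem_ofPred_eq] at hx hy
    simp only [σ] at h
    split_ifs at h <;> omega
  have hcard : #(A.image σ ∪ B) ≤ p - 2 := by
    refine (card_le_card (t := Ico 1 (p - 1)) ?_).trans (by simp; omega)
    apply union_subset
    · intro y hy
      obtain ⟨x, hx, rfl⟩ := mem_image.1 hy
      simp only [hAdef, mem_filter, mem_Ico] at hx
      simp only [σ, mem_Ico]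
      split_ifs <;> omega
    · exact filter_subset _ _
  -- The two degrees sum to more than `p` and each loses at most one to the other end, so `A` and
  -- `B` have together at least `p - 1` elements, for `p - 2` places.
  have hnd : ¬ Disjoint (A.image σ) B := by
    intro hdis
    rw [card_union_of_disjoint hdis, card_image_of_injOn hσ] at hcard
    omega
  rw [not_disjoint_iff] at hnd
  obtain ⟨y, hy, hyB⟩ := hnd
  obtain ⟨j, hj, rfl⟩ := mem_image.1 hy
  simp only [hAdef, hBdef, mem_filter, mem_Ico] at hj hyB
  by_cases hc : j + l ≤ p + 1
  · simp only [σ, hc, if_true] at hyB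
    exact ⟨_, isCycleSeq_of_parallel hg hl hj.1.1 hc hj.2 hyB.2.symm⟩
  · simp only [σ, hc, if_false] at hyB
    exact ⟨_, isCycleSeq_of_crossing_shortcut (i := j + l - 1 - p) hg hlp (by omega) (by omega)
      hj.2 hyB.2.symm⟩

theorem exists_isCycleSeq_top {p : ℕ} (hp : Fintype.card V = p) (hp2 : 2 ≤ p) :
    ∃ f, IsCycleSeq (⊤ : SimpleGraph V) p f := by
  have e : Fin p ≃ V := (Fintype.equivFinOfCardEq hp).symm
  have hinj : ∀ i < p, ∀ j < p, (if h : i < p then e ⟨i, h⟩ else e ⟨0, by omega⟩) =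
      (if h : j < p then e ⟨j, h⟩ else e ⟨0, by omega⟩) → i = j := by
    intro i hi j hj h
    simpa [hi, hj] using h
  refine ⟨fun i => if h : i < p then e ⟨i, h⟩ else e ⟨0, by omega⟩, hinj, ?_, ?_⟩
  · intro i hi h
    have := hinj _ (by omega) _ hi h
    omega
  · intro h
    have := hinj _ (by omega) _ (by omega) h
    omega

-- Path predecessors of neighbours of `f 0` cannot be adjacent to `f (p - 1)`, since crossing chords
-- would close a spanning cycle. Counting them makes the end degrees sum to less than `p`; the
-- maximality in `hmax`, applied to each predecessor and `f (p - 1)`, bounds its degree by that of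
-- `f 0`.
open Classical in
theorem exists_degree_le_of_path {G : SimpleGraph V} {p : ℕ} {f : ℕ → V}
    (hp : Fintype.card V = p) (hp3 : 3 ≤ p)
    (hinj : ∀ i < p, ∀ j < p, f i = f j → i = j)
    (hadj : ∀ i, i + 1 < p → G.Adj (f i) (f (i + 1))) (hG : ∀ g, ¬ IsCycleSeq G p g)
    (hmax : ∀ x y, x ≠ y → ¬ G.Adj x y →
      G.degree x + G.degree y ≤ G.degree (f 0) + G.degree (f (p - 1)))
    (hle : G.degree (f 0) ≤ G.degree (f (p - 1))) :
    2 * G.degree (f 0) < p ∧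
      G.degree (f 0) ≤ #{v | G.degree v ≤ G.degree (f 0)} := by
  set T := {i ∈ range (p - 1) | G.Adj (f 0) (f (i + 1))} with hT
  have hTinj : Set.InjOn f T := by
    intro x hx y hy h
    simp only [hT, coe_filter, mem_range, Set.mem_ofPred_eq] at hx hy
    exact hinj _ (by omega) _ (by omega) h
  have hTcard : G.degree (f 0) ≤ #T := by
    rw [degree_eq_card_filter hp hinj]
    refine (card_le_card (t := T.image (· + 1)) ?_).trans card_image_le
    intro j
    simp only [mem_filter, mem_range, mem_image, hT]
    rintro ⟨hj, hj'⟩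
    have hj0 : j ≠ 0 := by
      rintro rfl
      exact G.irrefl hj'
    have hj1 : j - 1 + 1 = j := by omega
    exact ⟨j - 1, ⟨by omega, by rwa [hj1]⟩, hj1⟩
  have hTnot : ∀ i ∈ T, ¬ G.Adj (f i) (f (p - 1)) := by
    intro i hi h
    simp only [hT, mem_filter, mem_range] at hi
    exact hG _ (isCycleSeq_of_crossing hinj hadj (by omega) hi.2 h)
  have hdeg : G.degree (f (p - 1)) + #T + 1 ≤ p := by
    have hsub : insert (f (p - 1)) (T.image f ∪ G.neighborFinset (f (p - 1))) ⊆ univ :=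
      subset_univ _
    have hc := card_le_card hsub
    rw [card_univ, hp, card_insert_of_notMem, card_union_of_disjoint,
      card_image_of_injOn hTinj, SimpleGraph.card_neighborFinset_eq_degree] at hc
    · omega
    · rw [disjoint_left]
      intro v hv hv'
      obtain ⟨i, hi, rfl⟩ := mem_image.1 hv
      exact hTnot i hi ((SimpleGraph.mem_neighborFinset _ _ _).1 hv').symm
    · simp only [mem_union, mem_image, SimpleGraph.mem_neighborFinset, SimpleGraph.irrefl,
        or_false, not_exists, not_and]
      intro i hi h
      simp only [hT, mem_filter, mem_range] at hi
      have := hinj _ (by omega) _ (by omega) h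
      omega
  refine ⟨by omega, hTcard.trans ?_⟩
  rw [← card_image_of_injOn hTinj]
  apply card_le_card
  intro v hv
  obtain ⟨i, hi, rfl⟩ := mem_image.1 hv
  have hne : f i ≠ f (p - 1) := by
    intro h
    simp only [hT, mem_filter, mem_range] at hi
    have := hinj _ (by omega) _ (by omega) h
    omega
  have := hmax _ _ hne (hTnot i hi)
  simp only [mem_filter, mem_univ, true_and]
  omega

open Classical in
/-- **Pósa's theorem** on Hamiltonian cycles. -/
theorem exists_spanning_isCycleSeq {G : SimpleGraph V} {p : ℕ} (hp : Fintype.card V = p)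
    (hp3 : 3 ≤ p) (hpos : ∀ s, 1 ≤ s → 2 * s < p → #{v | G.degree v ≤ s} < s) :
    ∃ f, IsCycleSeq G p f := by
  by_contra hcon
  -- An edge-maximal counterexample: adding any missing edge creates a spanning cycle, hence a
  -- spanning path between its ends. Pósa's condition survives because degrees only grow.
  obtain ⟨H, hGH, hH⟩ := Finite.exists_le_maximal
    (p := fun H : SimpleGraph V => ¬ ∃ f, IsCycleSeq H p f) hcon
  have hpos' : ∀ s, 1 ≤ s → 2 * s < p → #{v | H.degree v ≤ s} < s := by
    intro s hs hs'
    refine (card_le_card ?_).trans_lt (hpos s hs hs')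
    intro v
    simp only [mem_filter, mem_univ, true_and]
    exact (SimpleGraph.degree_le_of_le hGH).trans
  have hH0 : ∀ g, ¬ IsCycleSeq H p g := fun g hg => hH.prop ⟨g, hg⟩
  let P : Finset (V × V) := {x | x.1 ≠ x.2 ∧ ¬ H.Adj x.1 x.2}
  have hP : P.Nonempty := by
    by_contra hPe
    apply hH.prop
    obtain ⟨f, hf⟩ := exists_isCycleSeq_top hp (by omega)
    refine ⟨f, hf.mono fun x y hxy => ?_⟩
    by_contra hn
    exact hPe ⟨(x, y), by simpa [P] using ⟨hxy, hn⟩⟩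
  obtain ⟨⟨u, v⟩, huv, hmax⟩ := exists_max_image P (fun x => H.degree x.1 + H.degree x.2) hP
  simp only [P, mem_filter, mem_univ, true_and, Prod.forall] at huv hmax
  have hlt : H < H ⊔ SimpleGraph.edge u v := by
    refine lt_of_le_of_ne le_sup_left fun h => huv.2 ?_
    rw [h]
    simp [SimpleGraph.edge_adj, huv.1]
  obtain ⟨f, hf⟩ : ∃ f, IsCycleSeq (H ⊔ SimpleGraph.edge u v) p f := by
    by_contra h
    exact hH.not_prop_of_gt hlt h
  obtain ⟨g, hinj, hadj, hends⟩ := exists_path_of_isCycleSeq_sup_edge hp3 hf (hH0 f)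
  have hmax' : ∀ x y, x ≠ y → ¬ H.Adj x y →
      H.degree x + H.degree y ≤ H.degree (g 0) + H.degree (g (p - 1)) := by
    intro x y h1 h2
    have := hmax x y ⟨h1, h2⟩
    rcases hends with ⟨h3, h4⟩ | ⟨h3, h4⟩ <;> rw [h3, h4] <;> omega
  -- Stated for any path so that it also serves the reversed one: the end of smaller degree must
  -- come first.
  have hfin : ∀ (g : ℕ → V) (a b : V), g 0 = a → g (p - 1) = b → (∀ i < p, ∀ j < p, g i = g j → i = j) →
      (∀ i, i + 1 < p → H.Adj (g i) (g (i + 1))) →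
      (∀ x y, x ≠ y → ¬ H.Adj x y →
        H.degree x + H.degree y ≤ H.degree a + H.degree b) →
      H.degree a ≤ H.degree b → False := by
    rintro g _ _ rfl rfl h1 h2 h3 h4
    obtain ⟨h5, h6⟩ := exists_degree_le_of_path hp hp3 h1 h2 hH0 h3 h4
    -- The condition starts at `s = 1`, which also excludes an isolated end.
    rcases Nat.eq_zero_or_pos (H.degree (g 0)) with h7 | h7
    · have h8 := hpos' 1 le_rfl (by omega)
      have h9 : g 0 ∈ ({v | H.degree v ≤ 1} : Finset V) := by simp [h7]
      have := card_pos.2 ⟨_, h9⟩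
      omega
    · have := hpos' _ h7 h5
      omega
  rcases le_total (H.degree (g 0)) (H.degree (g (p - 1))) with h | h
  · exact hfin g _ _ rfl rfl hinj hadj hmax' h
  · refine hfin (fun t => g (p - 1 - t)) (g (p - 1)) (g 0) rfl (by simp) ?_ ?_ ?_ h
    · intro i hi j hj hij
      have := hinj _ (by omega) _ (by omega) hij
      omega
    · intro i hi
      have := (hadj (p - 1 - (i + 1)) (by omega)).symm
      rwa [show p - 1 - (i + 1) + 1 = p - 1 - i by omega] at this
    · intro x y h1 h2
      rw [add_comm (H.degree (g (p - 1)))]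
      exact hmax' x y h1 h2

end

end SpectralCycles

/-! ### Degree sums and the peeling argument -/

namespace SpectralCycles

open Finset

section
variable {V : Type*}

open scoped Classical in
/-- The number of neighbours of `v` in `S`. -/
noncomputable def degIn (G : SimpleGraph V) (S : Finset V) (v : V) : ℕ :=
  #{w ∈ S | G.Adj v w}

variable {G : SimpleGraph V}

theorem degIn_mono {A B : Finset V} (h : A ⊆ B) (v : V) : degIn G A v ≤ degIn G B v := by
  classical
  exact card_le_card (filter_subset_filter _ h)

theorem degIn_add_one_le {A : Finset V} {v : V} (hv : v ∈ A) : degIn G A v + 1 ≤ #A := by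
  classical
  refine Nat.succ_le_of_lt (card_lt_card ?_)
  rw [ssubset_iff_of_subset (filter_subset _ _)]
  exact ⟨v, hv, by simp⟩

theorem sum_degIn_comm (A B : Finset V) :
    ∑ v ∈ A, degIn G B v = ∑ w ∈ B, degIn G A w := by
  classical
  simp only [degIn, card_filter]
  rw [sum_comm]
  exact sum_congr rfl fun v _ => sum_congr rfl fun w _ => by simp only [G.adj_comm]

open Classical in
theorem degIn_insert {A : Finset V} {w : V} (hw : w ∉ A) (v : V) :
    degIn G (insert w A) v = degIn G A v + if G.Adj v w then 1 else 0 := by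
  simp only [degIn, card_filter]
  rw [sum_insert hw, add_comm]

theorem sum_degIn_insert [DecidableEq V] {A : Finset V} {w : V} (hw : w ∉ A) :
    ∑ v ∈ insert w A, degIn G (insert w A) v = ∑ v ∈ A, degIn G A v + 2 * degIn G A w := by
  classical
  have h : ∀ v, degIn G (insert w A) v = degIn G A v + if G.Adj v w then 1 else 0 := by
    intro v
    convert degIn_insert hw v
  rw [sum_insert hw]
  simp only [h, sum_add_distrib, SimpleGraph.irrefl, if_false, add_zero]
  rw [← card_filter]
  have : #{v ∈ A | G.Adj v w} = degIn G A w := by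
    simp only [degIn, G.adj_comm w]
  rw [this]
  ring

theorem degIn_add_degIn_sdiff [DecidableEq V] {A B : Finset V} (h : A ⊆ B) (v : V) :
    degIn G A v + degIn G (B \ A) v = degIn G B v := by
  classical
  simp only [degIn, card_filter]
  rw [add_comm]
  exact sum_sdiff h

/-- If `s` vertices of `S` have degree at most `s`, there are few edges. -/
theorem sum_degIn_add_le {S : Finset V} {s : ℕ}
    (h : s ≤ #{v ∈ S | degIn G S v ≤ s}) :
    ∑ v ∈ S, degIn G S v + (#S - s) ≤ (#S - s) ^ 2 + 2 * s ^ 2 := by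
  classical
  -- With `R = #S - s`, pairs inside `S \ T` contribute at most `R(R - 1)`; pairs meeting `T` at
  -- most twice its degree sum, so `2s²`.
  obtain ⟨T, hT, hTc⟩ := exists_subset_card_eq h
  have hTS : T ⊆ S := hT.trans (filter_subset _ _)
  have hTd : ∑ v ∈ T, degIn G S v ≤ s ^ 2 := by
    have : ∑ v ∈ T, degIn G S v ≤ ∑ v ∈ T, s :=
      sum_le_sum fun v hv => (mem_filter.1 (hT hv)).2
    rw [sum_const, smul_eq_mul, hTc] at this
    nlinarith
  have hR : #(S \ T) = #S - s := by rw [card_sdiff_of_subset hTS, hTc]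
  have h1 : ∑ v ∈ S, degIn G S v = ∑ v ∈ S \ T, degIn G S v + ∑ v ∈ T, degIn G S v :=
    (sum_sdiff hTS).symm
  have h2 : ∑ v ∈ S \ T, degIn G S v
      = ∑ v ∈ S \ T, degIn G T v + ∑ v ∈ S \ T, degIn G (S \ T) v := by
    rw [← sum_add_distrib]
    exact sum_congr rfl fun v _ => (degIn_add_degIn_sdiff hTS v).symm
  have h3 : ∑ v ∈ S \ T, degIn G T v ≤ ∑ v ∈ T, degIn G S v := by
    rw [sum_degIn_comm]
    exact sum_le_sum fun v _ => degIn_mono sdiff_subset v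
  have h4 : ∑ v ∈ S \ T, degIn G (S \ T) v + #(S \ T) ≤ #(S \ T) ^ 2 := by
    have : ∑ v ∈ S \ T, (degIn G (S \ T) v + 1) ≤ ∑ v ∈ S \ T, #(S \ T) :=
      sum_le_sum fun v hv => degIn_add_one_le hv
    rw [sum_add_distrib, sum_const, sum_const, smul_eq_mul, smul_eq_mul] at this
    nlinarith
  rw [hR] at h4
  omega

open Classical in
theorem degree_comap_subtype (S : Finset V) (v : S) :
    (G.comap (Subtype.val : S → V)).degree v = degIn G S v := by
  rw [← SimpleGraph.card_neighborFinset_eq_degree, SimpleGraph.neighborFinset_eq_filter, degIn,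
    card_filter, card_filter, ← sum_coe_sort S]
  simp

/-- The bound of `sum_degIn_add_le` is convex in `s`, so it suffices to beat it at the end points `s
= i + 2` and `s = (a + i - 1) / 2`. The two cases compare `s` with one end point each. -/
theorem quadratic_threshold {a i s D R : ℤ} (hi : 0 ≤ i) (h1 : 5 * i + 11 ≤ a)
    (h2 : i ^ 2 + 5 * i + 12 ≤ 2 * a) (hR : R = a + i - s) (hs : i + 2 ≤ s)
    (hs' : 2 * s + 1 ≤ a + i)
    (hD : a ^ 2 + (i + 2) * (i + 1) + 6 ≤ D + 3 * a) : R ^ 2 + 2 * s ^ 2 < D + R := by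
  subst hR
  by_cases hc : 3 * (s + i + 2) ≤ 2 * (a + i) - 1
  · have : 0 ≤ (s - (i + 2)) * (2 * (a + i) - 1 - 3 * (s + i + 2)) :=
      mul_nonneg (by linarith) (by linarith)
    nlinarith
  -- Four times the inequality at the upper end point. For small `i` the linear bound on `a`
  -- suffices, from `i = 8` on the quadratic one.
  · have key : 0 < a * (a - 6 * i - 8) + i ^ 2 + 16 * i + 31 := by
      by_cases hi8 : i ≤ 7
      · interval_cases i <;> nlinarith
      · have : 0 < a - 6 * i - 8 := by nlinarith
        have : 0 < a * (a - 6 * i - 8) := mul_pos (by linarith) this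
        nlinarith
    have : 0 ≤ (a + i - 1 - 2 * s) * (6 * s - (a + i) - 1) :=
      mul_nonneg (by linarith) (by linarith)
    nlinarith

/-- Pósa's condition is assumed below `i + 2`; from there on density alone rules out `s` vertices of
degree at most `s`. -/
theorem isContained_of_dense {S : Finset V} {a i : ℕ} (hS : #S = a + i)
    (h1 : 5 * i + 11 ≤ a) (h2 : i ^ 2 + 5 * i + 12 ≤ 2 * a)
    (hD : a ^ 2 + (i + 2) * (i + 1) + 6 ≤ ∑ v ∈ S, degIn G S v + 3 * a)
    (hlow : ∀ s, 1 ≤ s → s < i + 2 → #{v ∈ S | degIn G S v ≤ s} < s)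
    {l : ℕ} (hl : 3 ≤ l) (hl' : l ≤ a + i) : (SimpleGraph.cycleGraph l).IsContained G := by
  classical
  have hcard : Fintype.card S = a + i := by simpa using hS
  set H := G.comap (Subtype.val : S → V) with hH
  have hdeg : ∀ v : S, H.degree v = degIn G S v := fun v => degree_comap_subtype S v
  have hsum : ∑ v : S, H.degree v = ∑ v ∈ S, degIn G S v := by
    simp only [hdeg]
    exact sum_coe_sort S (degIn G S)
  have hpos : ∀ s, 1 ≤ s → 2 * s < a + i → #{v : S | H.degree v ≤ s} < s := by
    intro s hs hs'
    have hcount : #{v : S | H.degree v ≤ s} = #{v ∈ S | degIn G S v ≤ s} := by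
      simp only [hdeg]
      rw [card_filter, card_filter]
      exact sum_coe_sort S (fun v => if degIn G S v ≤ s then 1 else 0)
    rw [hcount]
    by_cases hsi : s < i + 2
    · exact hlow s hs hsi
    · by_contra hcon
      have hb := sum_degIn_add_le (G := G) (S := S) (s := s) (by omega)
      rw [hS] at hb
      have := quadratic_threshold (a := a) (i := i) (s := s)
        (D := (∑ v ∈ S, degIn G S v : ℕ)) (R := (a + i - s : ℕ)) (by positivity)
        (by exact_mod_cast h1) (by exact_mod_cast h2) (by push_cast [show s ≤ a + i by omega]; ring)
        (by omega) (by omega) (by exact_mod_cast hD)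
      have hb' : ((∑ v ∈ S, degIn G S v + (a + i - s) : ℕ) : ℤ)
          ≤ (((a + i - s) ^ 2 + 2 * s ^ 2 : ℕ) : ℤ) := by exact_mod_cast hb
      push_cast at hb' this
      linarith
  obtain ⟨f, hf⟩ := exists_spanning_isCycleSeq hcard (by omega) hpos
  have hbig : (a + i) ^ 2 < 2 * ∑ v : S, H.degree v := by
    rw [hsum]
    nlinarith [Nat.mul_le_mul h1 (le_refl a)]
  obtain ⟨g, hg⟩ := exists_isCycleSeq_of_spanning hcard hf hbig hl hl'
  exact (hg.isContained hl).trans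
    ⟨⟨⟨Subtype.val, fun h => h⟩, Subtype.val_injective⟩⟩

variable [Fintype V]

theorem exists_dense_subset {a k : ℕ} (hV : Fintype.card V = a + k)
    (h1 : 5 * k + 11 ≤ a) (h2 : k ^ 2 + 5 * k + 12 ≤ 2 * a)
    (hD : a ^ 2 + (k + 2) * (k + 1) + 6 ≤ ∑ v, degIn G univ v + 3 * a)
    {l : ℕ} (hl : 3 ≤ l) (hl' : l ≤ a + 1) (hcyc : ¬ (SimpleGraph.cycleGraph l).IsContained G) :
    ∃ S : Finset V, #S = a ∧ a ^ 2 + 8 ≤ ∑ v ∈ S, degIn G S v + 3 * a := by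
  classical
  -- Deleting a vertex of degree at most `i + 2` costs at most `2(i + 2) = (i+3)(i+2) - (i+2)(i+1)`,
  -- exactly the drop of the threshold from `i + 1` to `i`.
  have step : ∀ m ≤ k, ∃ S : Finset V, #S = a + (k - m) ∧
      a ^ 2 + ((k - m) + 2) * ((k - m) + 1) + 6 ≤ ∑ v ∈ S, degIn G S v + 3 * a := by
    intro m
    induction m with
    | zero => exact fun _ => ⟨univ, by simpa using hV, by simpa using hD⟩
    | succ m ih =>
      intro hm
      obtain ⟨S, hS, hSD⟩ := ih (by omega)
      obtain ⟨i, hi⟩ : ∃ i, k - m = i + 1 := ⟨k - m - 1, by omega⟩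
      have hi' : k - (m + 1) = i := by omega
      have hik : i + 1 ≤ k := by omega
      rw [hi] at hS hSD
      rw [hi']
      by_cases hv : ∃ v ∈ S, degIn G S v ≤ i + 2
      · obtain ⟨v, hv, hdv⟩ := hv
        refine ⟨S.erase v, by rw [card_erase_of_mem hv]; omega, ?_⟩
        have hins := sum_degIn_insert (G := G) (notMem_erase v S)
        rw [insert_erase hv] at hins
        have hle := (degIn_mono (G := G) (erase_subset v S) v).trans hdv
        nlinarith
      · push Not at hv
        refine absurd (isContained_of_dense hS (by omega) (by nlinarith) hSD ?_ hl (by omega)) hcyc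
        intro s hs hs'
        rw [filter_false_of_mem, card_empty]
        · omega
        · intro v hv'
          have := hv v hv'
          omega
  obtain ⟨S, hS, hSD⟩ := step k le_rfl
  rw [Nat.sub_self] at hS hSD
  exact ⟨S, hS, by omega⟩

/-- A dense graph without a cycle of some length `l ≤ a + 1` has a set of `a` vertices to which
every other vertex has at most one neighbour. -/
theorem exists_subset_degIn_le_one {a k : ℕ} (hk : 1 ≤ k) (hV : Fintype.card V = a + k)
    (h1 : 5 * k + 11 ≤ a) (h2 : k ^ 2 + 5 * k + 12 ≤ 2 * a)
    (hD : a ^ 2 + (k + 2) * (k + 1) + 6 ≤ ∑ v, degIn G univ v + 3 * a)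
    {l : ℕ} (hl : 3 ≤ l) (hl' : l ≤ a + 1) (hcyc : ¬ (SimpleGraph.cycleGraph l).IsContained G) :
    ∃ S : Finset V, #S = a ∧ ∀ w ∉ S, degIn G S w ≤ 1 := by
  classical
  obtain ⟨S, hS, hSD⟩ := exists_dense_subset hV h1 h2 hD hl hl' hcyc
  refine ⟨S, hS, fun w hw => ?_⟩
  by_contra! hdw
  -- A degree of at most 2 would leave a degree sum of at most `(a-1)(a-2) + 4 = a² - 3a + 6`.
  have hmin : ∀ v ∈ S, 3 ≤ degIn G S v := by
    intro v hv
    have hins := sum_degIn_insert (G := G) (notMem_erase v S)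
    rw [insert_erase hv] at hins
    have hself : degIn G (S.erase v) v ≤ degIn G S v := degIn_mono (erase_subset v S) v
    have hle : ∑ u ∈ S.erase v, (degIn G (S.erase v) u + 1) ≤ ∑ u ∈ S.erase v, (a - 1) := by
      refine sum_le_sum fun u hu => (degIn_add_one_le hu).trans ?_
      rw [card_erase_of_mem hv, hS]
    rw [sum_add_distrib, sum_const, sum_const, smul_eq_mul, smul_eq_mul, card_erase_of_mem hv,
      hS] at hle
    obtain ⟨b, rfl⟩ : ∃ b, a = b + 1 := ⟨a - 1, by omega⟩
    rw [Nat.add_sub_cancel] at hle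
    nlinarith
  -- Two neighbours of `w` add 4 to the degree sum, and `8 + 4 = 3 · 2 + 6` is the threshold at `i =
  -- 1`.
  refine hcyc (isContained_of_dense (S := insert w S) (a := a) (i := 1)
    (by rw [card_insert_of_notMem hw, hS]) (by omega) (by omega) ?_ ?_ hl hl')
  · rw [sum_degIn_insert hw]
    omega
  · intro s hs hs3
    have hsub : {v ∈ insert w S | degIn G (insert w S) v ≤ s} ⊆ {w} := by
      intro v
      simp only [mem_filter, mem_insert, mem_singleton]
      rintro ⟨h | h, h'⟩
      · exact h
      · have := (hmin v h).trans (degIn_mono (subset_insert w S) v)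
        omega
    have hle := card_le_card hsub
    rw [card_singleton] at hle
    by_cases hs1 : s = 1
    · subst hs1
      have : w ∉ ({v ∈ insert w S | degIn G (insert w S) v ≤ 1} : Finset V) := by
        simp only [mem_filter, not_and, not_le]
        intro _
        exact lt_of_lt_of_le hdw (degIn_mono (subset_insert w S) w)
      rw [(subset_singleton_iff.1 hsub).resolve_right (fun h => this (h ▸ mem_singleton_self w))]
      simp
    · omega

end

end SpectralCycles

/-! ### The largest eigenvalue of `A + tD` -/

namespace SpectralCycles

open Finset Matrix

theorem cast_degIn {V : Type*} (G : SimpleGraph V) (S : Finset V) (u : V) [DecidableRel G.Adj] :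
    (degIn G S u : ℝ) = ∑ v ∈ S, if G.Adj u v then (1 : ℝ) else 0 := by
  rw [degIn, card_filter]
  push_cast
  refine sum_congr rfl fun v _ => ?_
  congr

theorem degIn_of_isClique {V : Type*} {G : SimpleGraph V} {S : Finset V}
    (hS : ∀ u ∈ S, ∀ v ∈ S, u ≠ v → G.Adj u v) {u : V} (hu : u ∈ S) :
    degIn G S u + 1 = #S := by
  classical
  rw [degIn, ← card_erase_add_one hu]
  congr 2
  ext v
  simp only [mem_filter, mem_erase]
  exact ⟨fun h => ⟨h.2.ne', h.1⟩, fun h => ⟨h.2, hS u hu v h.2 h.1.symm⟩⟩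

section
variable {V : Type*} [Fintype V]

theorem hasEigenvalue_toLin'_iff [DecidableEq V] {M : Matrix V V ℝ} {μ : ℝ} :
    Module.End.HasEigenvalue (Matrix.toLin' M) μ ↔ ∃ x, x ≠ 0 ∧ M *ᵥ x = μ • x := by
  constructor
  · intro h
    obtain ⟨x, hx⟩ := h.exists_hasEigenvector
    exact ⟨x, hx.2, by simpa using hx.apply_eq_smul⟩
  · rintro ⟨x, hx, h⟩
    exact Module.End.hasEigenvalue_of_hasEigenvector
      ⟨Module.End.mem_eigenspace_iff.2 (by simpa using h), hx⟩

theorem posSemidef_largestEigenvalue_sub [DecidableEq V] [Nonempty V] {M : Matrix V V ℝ}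
    (hM : M.IsHermitian) : (largestEigenvalue M • (1 : Matrix V V ℝ) - M).PosSemidef := by
  rw [Matrix.posSemidef_iff_isHermitian_and_spectrum_nonneg]
  constructor
  · exact (Matrix.isHermitian_one.smul (by simp [IsSelfAdjoint])).sub hM
  · intro μ hμ
    rw [← Matrix.spectrum_toLin', ← Module.End.hasEigenvalue_iff_mem_spectrum,
      hasEigenvalue_toLin'_iff] at hμ
    obtain ⟨x, hx, h⟩ := hμ
    rw [sub_mulVec, smul_mulVec, one_mulVec] at h
    have h2 : M *ᵥ x = (largestEigenvalue M - μ) • x := by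
      rw [sub_smul, ← h]
      abel
    have := (isGreatest_largestEigenvalue hM).2 (hasEigenvalue_toLin'_iff.2 ⟨x, hx, h2⟩)
    change 0 ≤ μ
    linarith

theorem dotProduct_mulVec_le_largestEigenvalue [DecidableEq V] [Nonempty V] {M : Matrix V V ℝ}
    (hM : M.IsHermitian) (x : V → ℝ) : x ⬝ᵥ M *ᵥ x ≤ largestEigenvalue M * (x ⬝ᵥ x) := by
  have h := (posSemidef_largestEigenvalue_sub hM).dotProduct_mulVec_nonneg x
  rw [sub_mulVec, smul_mulVec, one_mulVec, dotProduct_sub, dotProduct_smul, star_trivial,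
    smul_eq_mul] at h
  linarith

/-- A positive semidefinite form, here that of `λI - M`, vanishes only on its kernel. -/
theorem mulVec_eq_of_dotProduct_mulVec_eq [DecidableEq V] [Nonempty V] {M : Matrix V V ℝ}
    (hM : M.IsHermitian) {x : V → ℝ} (hx : largestEigenvalue M * (x ⬝ᵥ x) ≤ x ⬝ᵥ M *ᵥ x) :
    M *ᵥ x = largestEigenvalue M • x := by
  have h := ((posSemidef_largestEigenvalue_sub hM).dotProduct_mulVec_zero_iff x).1
  have hle := dotProduct_mulVec_le_largestEigenvalue hM x
  rw [sub_mulVec, smul_mulVec, one_mulVec, dotProduct_sub, dotProduct_smul, star_trivial,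
    smul_eq_mul] at h
  exact (sub_eq_zero.1 (h (by linarith))).symm

/-- Taking absolute values preserves the norm and does not lower the form of a nonnegative matrix.
No irreducibility is needed, so entries may vanish. -/
theorem exists_nonneg_eigenvector [DecidableEq V] [Nonempty V] {M : Matrix V V ℝ}
    (hM : M.IsHermitian) (hM0 : ∀ i j, 0 ≤ M i j) :
    ∃ x : V → ℝ, x ≠ 0 ∧ (∀ v, 0 ≤ x v) ∧ M *ᵥ x = largestEigenvalue M • x := by
  obtain ⟨y, hy, h⟩ := hasEigenvalue_toLin'_iff.1 (isGreatest_largestEigenvalue hM).1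
  refine ⟨fun v => |y v|, ?_, fun v => abs_nonneg _, ?_⟩
  · intro h0
    exact hy (funext fun v => abs_eq_zero.1 (congrFun h0 v))
  · apply mulVec_eq_of_dotProduct_mulVec_eq hM
    have h1 : (fun v => |y v|) ⬝ᵥ (fun v => |y v|) = y ⬝ᵥ y := by
      simp [dotProduct]
    rw [h1]
    have h2 : y ⬝ᵥ M *ᵥ y = largestEigenvalue M * (y ⬝ᵥ y) := by
      rw [h, dotProduct_smul, smul_eq_mul]
    rw [← h2]
    simp only [dotProduct, mulVec, mul_sum]
    refine sum_le_sum fun i _ => sum_le_sum fun j _ => ?_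
    calc y i * (M i j * y j) ≤ |y i * (M i j * y j)| := le_abs_self _
      _ = |y i| * (M i j * |y j|) := by rw [abs_mul, abs_mul, abs_of_nonneg (hM0 i j)]

open Classical in
/-- The matrix `A(G) + t D(G)`. -/
noncomputable def weightedMatrix (t : ℝ) (G : SimpleGraph V) : Matrix V V ℝ :=
  G.adjMatrix ℝ + t • G.degMatrix ℝ

open Classical in
/-- The largest eigenvalue of `A(G) + t D(G)`. -/
noncomputable def weightedRadius (t : ℝ) (G : SimpleGraph V) : ℝ :=
  largestEigenvalue (weightedMatrix t G)

theorem rho_eq_weightedRadius (G : SimpleGraph V) : rho G = weightedRadius 0 G := by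
  simp [rho, weightedRadius, weightedMatrix]

theorem q_eq_weightedRadius (G : SimpleGraph V) : q G = weightedRadius 1 G := by
  simp [q, weightedRadius, weightedMatrix]

theorem isHermitian_weightedMatrix (t : ℝ) (G : SimpleGraph V) :
    (weightedMatrix t G).IsHermitian := by
  classical
  unfold Matrix.IsHermitian
  rw [conjTranspose_eq_transpose_of_trivial, weightedMatrix, transpose_add, transpose_smul,
    SimpleGraph.transpose_adjMatrix, SimpleGraph.degMatrix, diagonal_transpose]

theorem weightedMatrix_nonneg {t : ℝ} (ht : 0 ≤ t) (G : SimpleGraph V) (u v : V) :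
    0 ≤ weightedMatrix t G u v := by
  classical
  simp only [weightedMatrix, SimpleGraph.degMatrix, Matrix.add_apply, Matrix.smul_apply,
    SimpleGraph.adjMatrix_apply, diagonal_apply, smul_eq_mul]
  split_ifs <;> positivity

open Classical in
theorem weightedMatrix_mulVec (t : ℝ) (G : SimpleGraph V) (x : V → ℝ) (u : V) :
    (weightedMatrix t G *ᵥ x) u = ∑ v, if G.Adj u v then x v + t * x u else 0 := by
  rw [weightedMatrix, add_mulVec, smul_mulVec, Pi.add_apply, Pi.smul_apply,
    SimpleGraph.adjMatrix_mulVec_apply, SimpleGraph.degMatrix, mulVec_diagonal,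
    SimpleGraph.neighborFinset_eq_filter, sum_filter, ← SimpleGraph.card_neighborFinset_eq_degree,
    SimpleGraph.neighborFinset_eq_filter, card_filter]
  push_cast
  rw [sum_mul, smul_eq_mul, mul_sum, ← sum_add_distrib]
  refine sum_congr rfl fun v _ => ?_
  split_ifs <;> simp

theorem exists_eigenvector_of_iso {W : Type*} [Fintype W] {G : SimpleGraph V}
    {H : SimpleGraph W} (e : G ≃g H) {t μ : ℝ}
    (h : ∃ x, x ≠ 0 ∧ weightedMatrix t G *ᵥ x = μ • x) :
    ∃ x, x ≠ 0 ∧ weightedMatrix t H *ᵥ x = μ • x := by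
  classical
  obtain ⟨x, hx, h⟩ := h
  refine ⟨x ∘ e.symm, ?_, ?_⟩
  · intro h0
    apply hx
    funext v
    simpa using congrFun h0 (e v)
  · funext w
    have := congrFun h (e.symm w)
    rw [weightedMatrix_mulVec] at this
    rw [weightedMatrix_mulVec, ← e.toEquiv.sum_comp]
    simp only [Function.comp, Pi.smul_apply] at this ⊢
    rw [← this]
    refine sum_congr rfl fun v _ => ?_
    have hadj : H.Adj w (e v) ↔ G.Adj (e.symm w) v := by
      rw [← e.map_adj_iff, e.apply_symm_apply]
    have hv : e.symm (e v) = v := e.symm_apply_apply v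
    simp [hadj, hv]

theorem weightedRadius_congr {W : Type*} [Fintype W] {G : SimpleGraph V} {H : SimpleGraph W}
    (e : G ≃g H) (t : ℝ) : weightedRadius t G = weightedRadius t H := by
  classical
  unfold weightedRadius largestEigenvalue
  congr 1
  ext μ
  simp only [Set.mem_ofPred_eq, hasEigenvalue_toLin'_iff]
  exact ⟨exists_eigenvector_of_iso e, exists_eigenvector_of_iso e.symm⟩

open Classical in
theorem dotProduct_weightedMatrix_mulVec (t : ℝ) (G : SimpleGraph V) (x : V → ℝ) :
    x ⬝ᵥ weightedMatrix t G *ᵥ x =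
      ∑ u, ∑ v, if G.Adj u v then x u * x v + t * (x u ^ 2 + x v ^ 2) / 2 else 0 := by
  have h1 : x ⬝ᵥ weightedMatrix t G *ᵥ x =
      ∑ u, ∑ v, if G.Adj u v then x u * x v + t * x u ^ 2 else 0 := by
    simp only [dotProduct, weightedMatrix_mulVec, mul_sum]
    refine sum_congr rfl fun u _ => sum_congr rfl fun v _ => ?_
    split_ifs <;> ring
  have h2 : x ⬝ᵥ weightedMatrix t G *ᵥ x =
      ∑ u, ∑ v, if G.Adj u v then x u * x v + t * x v ^ 2 else 0 := by
    rw [h1, sum_comm]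
    refine sum_congr rfl fun u _ => sum_congr rfl fun v _ => ?_
    simp only [G.adj_comm]
    split_ifs <;> ring
  have h3 : x ⬝ᵥ weightedMatrix t G *ᵥ x =
      (x ⬝ᵥ weightedMatrix t G *ᵥ x + x ⬝ᵥ weightedMatrix t G *ᵥ x) / 2 := by ring
  rw [h3]
  nth_rewrite 1 [h1]
  rw [h2, ← sum_add_distrib, sum_div]
  refine sum_congr rfl fun u _ => ?_
  rw [← sum_add_distrib, sum_div]
  refine sum_congr rfl fun v _ => ?_
  split_ifs <;> ring

/-- A lower bound from a clique with an edge leaving it. -/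
theorem le_weightedRadius_of_isClique {G : SimpleGraph V} {S : Finset V} {t : ℝ} (ht : 0 ≤ t)
    (hS : ∀ u ∈ S, ∀ v ∈ S, u ≠ v → G.Adj u v) {h w : V} (hh : h ∈ S) (hw : w ∉ S)
    (hhw : G.Adj h w) :
    (1 + t) * (#S - 1) * #S + t ≤ weightedRadius t G * #S := by
  classical
  have : Nonempty V := ⟨h⟩
  -- Test vector: the indicator of `S`. The leaving edge enters through the degree of `h`, giving
  -- the extra `t`.
  have hR := dotProduct_mulVec_le_largestEigenvalue (isHermitian_weightedMatrix t G)
    (fun v => if v ∈ S then 1 else 0)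
  have h1 : (fun v => if v ∈ S then (1 : ℝ) else 0) ⬝ᵥ (fun v => if v ∈ S then (1 : ℝ) else 0)
      = #S := by
    simp [dotProduct]
  have hrow : ∀ u ∈ S, (weightedMatrix t G *ᵥ fun v => if v ∈ S then (1 : ℝ) else 0) u =
      degIn G S u + t * degIn G univ u := by
    intro u hu
    rw [weightedMatrix_mulVec, cast_degIn, cast_degIn, mul_sum, ← univ_inter S,
      ← filter_mem_eq_inter, sum_filter, ← sum_add_distrib]
    refine sum_congr rfl fun v _ => ?_
    simp only [mem_filter, mem_univ, true_and, hu, if_true]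
    split_ifs <;> simp
  have h2 : (fun v => if v ∈ S then (1 : ℝ) else 0) ⬝ᵥ
      weightedMatrix t G *ᵥ (fun v => if v ∈ S then (1 : ℝ) else 0) =
      ∑ u ∈ S, (degIn G S u + t * degIn G univ u : ℝ) := by
    rw [dotProduct]
    simp only [ite_mul, one_mul, zero_mul]
    rw [← sum_filter, filter_mem_eq_inter, univ_inter]
    exact sum_congr rfl hrow
  rw [h1, h2] at hR
  refine le_trans ?_ hR
  have hS1 : ∀ u ∈ S, (degIn G S u : ℝ) = #S - 1 := by
    intro u hu
    rw [← degIn_of_isClique hS hu]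
    push_cast
    ring
  have hlow : ∀ u ∈ S, (1 + t) * (#S - 1) + (if u = h then t else 0) ≤
      (degIn G S u + t * degIn G univ u : ℝ) := by
    intro u hu
    have hmono : degIn G S u + (if u = h then 1 else 0) ≤ degIn G univ u := by
      refine le_trans ?_ (degIn_mono (subset_univ (insert w S)) u)
      rw [degIn_insert hw]
      split_ifs with c1 c2 <;> first | omega | (subst c1; exact absurd hhw c2)
    have hmono' : (degIn G S u : ℝ) + (if u = h then 1 else 0) ≤ degIn G univ u := by
      exact_mod_cast hmono
    have := mul_le_mul_of_nonneg_left hmono' ht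
    rw [hS1 u hu] at this ⊢
    split_ifs at this ⊢ <;> linarith
  calc (1 + t) * (#S - 1) * #S + t
      = ∑ u ∈ S, ((1 + t) * (#S - 1) + (if u = h then t else 0)) := by
        rw [sum_add_distrib, sum_const, sum_ite_eq' S h, if_pos hh, nsmul_eq_mul]
        ring
    _ ≤ _ := sum_le_sum hlow

end
end SpectralCycles

/-! ### From the radius to the degree sum -/

namespace SpectralCycles

open Finset Matrix

section
variable {V : Type*} [Fintype V]

theorem exists_nonneg_weightedMatrix_eigenvector [Nonempty V] {t : ℝ} (ht : 0 ≤ t)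
    (G : SimpleGraph V) : ∃ x : V → ℝ, x ≠ 0 ∧ (∀ v, 0 ≤ x v) ∧
      weightedMatrix t G *ᵥ x = weightedRadius t G • x := by
  classical
  obtain ⟨x, h0, h1, h2⟩ := exists_nonneg_eigenvector (isHermitian_weightedMatrix t G)
    (weightedMatrix_nonneg ht G)
  refine ⟨x, h0, h1, ?_⟩
  rw [h2, weightedRadius]

open Classical in
theorem sum_neighbor_degIn_add_le (G : SimpleGraph V) (u : V) :
    ∑ v, (if G.Adj u v then degIn G univ v else 0) + degIn G univ u ≤ ∑ v, degIn G univ v := by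
  rw [← sum_erase_add univ _ (mem_univ u), ← sum_erase_add univ (degIn G univ) (mem_univ u)]
  simp only [SimpleGraph.irrefl, if_false, add_zero]
  gcongr with v
  split_ifs <;> simp

/-- **Stanley's inequality**. -/
theorem weightedRadius_zero_mul_le [Nonempty V] (G : SimpleGraph V) :
    weightedRadius 0 G * (weightedRadius 0 G + 1) ≤ ∑ v, degIn G univ v := by
  classical
  obtain ⟨x, hx, hx0, h⟩ := exists_nonneg_weightedMatrix_eigenvector le_rfl G
  set r := weightedRadius 0 G
  have hrow : ∀ v, r * x v = ∑ w, if G.Adj v w then x w else 0 := by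
    intro v
    have := congrFun h v
    rw [weightedMatrix_mulVec] at this
    simpa using this.symm
  -- At a largest entry, `r² x u` is at most `x u` times the degrees summed over neighbours of `u`;
  -- `r x u ≤ d(u) x u` supplies the linear term.
  obtain ⟨u, -, hu⟩ := exists_max_image univ x univ_nonempty
  have hupos : 0 < x u := by
    refine lt_of_le_of_ne (hx0 u) fun h => hx (funext fun v => ?_)
    exact le_antisymm ((hu v (mem_univ v)).trans h.symm.le) (hx0 v)
  have hle : ∀ v, r * x v ≤ degIn G univ v * x u := by
    intro v
    rw [hrow, cast_degIn, sum_mul]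
    refine sum_le_sum fun w _ => ?_
    split_ifs
    · simpa using hu w (mem_univ w)
    · simp
  have h2 : r * (r * x u) ≤ (∑ v, (if G.Adj u v then degIn G univ v else 0) : ℕ) * x u := by
    rw [hrow u, mul_sum]
    push_cast
    rw [sum_mul]
    refine sum_le_sum fun v _ => ?_
    split_ifs
    · exact hle v
    · simp
  have h3 : ((∑ v, (if G.Adj u v then degIn G univ v else 0) : ℕ) : ℝ) + degIn G univ u ≤
      (∑ v, degIn G univ v : ℕ) := by
    exact_mod_cast sum_neighbor_degIn_add_le G u
  have h4 := mul_le_mul_of_nonneg_right h3 hupos.le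
  have h5 : (r * (r + 1)) * x u ≤ (∑ v, degIn G univ v : ℕ) * x u := by
    nlinarith [hle u]
  have h6 := le_of_mul_le_mul_right h5 hupos
  exact_mod_cast h6

/-- At a vertex `u` maximising `x v / d v`, the eigenvalue equation gives `(r - d u) d u ≤ ∑ d v`
over the neighbours of `u`, so the degree sum is at least `d u (r - d u + 1)`. -/
theorem lt_sum_degIn_of_lt_weightedRadius_one [Nonempty V] {G : SimpleGraph V} {n k : ℕ}
    (hn : Fintype.card V = n) (hk : k + 1 ≤ n) (hr : 2 * (n - k - 1 : ℝ) < weightedRadius 1 G) :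
    ((n : ℝ) - 1) * (n - 2 * k) < ∑ v, degIn G univ v := by
  classical
  obtain ⟨x, hx, hx0, h⟩ := exists_nonneg_weightedMatrix_eigenvector zero_le_one G
  set r := weightedRadius 1 G
  have hk' : (k : ℝ) + 1 ≤ n := by exact_mod_cast hk
  have hr0 : 0 < r := by linarith
  set d : V → ℝ := fun v => degIn G univ v with hd
  have hd0 : ∀ v, 0 ≤ d v := fun v => Nat.cast_nonneg _
  have hrow : ∀ v, (r - d v) * x v = ∑ w, if G.Adj v w then x w else 0 := by
    intro v
    have := congrFun h v
    rw [weightedMatrix_mulVec] at this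
    have h2 : (∑ w, if G.Adj v w then x w + 1 * x v else 0) =
        (∑ w, if G.Adj v w then x w else 0) + d v * x v := by
      simp only [hd]
      rw [cast_degIn, sum_mul, ← sum_add_distrib]
      refine sum_congr rfl fun w _ => ?_
      split_ifs <;> simp
    rw [h2, Pi.smul_apply, smul_eq_mul] at this
    linarith
  -- Isolated vertices get the quotient `0`, harmlessly: `x` vanishes there because `r > 0`.
  obtain ⟨u, -, hu⟩ := exists_max_image univ (fun v => x v / d v) univ_nonempty
  set y := x u / d u with hy
  have hxle : ∀ v, x v ≤ y * d v := by
    intro v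
    rcases (hd0 v).eq_or_lt with h0 | h0
    · have h1 := hrow v
      have h2 : (∑ w, if G.Adj v w then x w else 0) = 0 := by
        refine sum_eq_zero fun w _ => ?_
        rw [if_neg]
        intro hvw
        have : degIn G univ v = 0 := by
          simp only [hd] at h0
          exact_mod_cast h0.symm
        rw [degIn, card_eq_zero, filter_eq_empty_iff] at this
        exact this (mem_univ w) hvw
      rw [h2, ← h0, sub_zero] at h1
      have : x v = 0 := (mul_eq_zero.1 h1).resolve_left hr0.ne'
      rw [this, ← h0, mul_zero]
    · rw [← div_le_iff₀ h0]
      exact hu v (mem_univ v)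
  have hy0 : 0 < y := by
    by_contra hcon
    refine hx (funext fun v => le_antisymm ?_ (hx0 v))
    exact (hxle v).trans (mul_nonpos_of_nonpos_of_nonneg (not_lt.1 hcon) (hd0 v))
  have hdu : 0 < d u := by
    refine lt_of_le_of_ne (hd0 u) fun h => ?_
    rw [hy, ← h, div_zero] at hy0
    exact lt_irrefl _ hy0
  have hxu : x u = y * d u := by rw [hy, div_mul_cancel₀ _ hdu.ne']
  set s : ℝ := ∑ v, if G.Adj u v then d v else 0 with hs
  have hsum : (r - d u) * d u ≤ s := by
    have h1 : (r - d u) * x u ≤ y * s := by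
      rw [hrow u, hs, mul_sum]
      refine sum_le_sum fun v _ => ?_
      split_ifs
      · exact hxle v
      · simp
    rw [hxu] at h1
    have h2 : y * ((r - d u) * d u) ≤ y * s := by linarith
    exact le_of_mul_le_mul_left h2 hy0
  have hs1 : s + d u ≤ (∑ v, degIn G univ v : ℕ) := by
    have := sum_neighbor_degIn_add_le G u
    have h2 : ((∑ v, (if G.Adj u v then degIn G univ v else 0) + degIn G univ u : ℕ) : ℝ) ≤
      (∑ v, degIn G univ v : ℕ) := by exact_mod_cast this
    push_cast at h2 ⊢
    exact h2
  have hdn : ∀ v, d v ≤ n - 1 := by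
    intro v
    have := degIn_add_one_le (G := G) (mem_univ v)
    have h2 : ((degIn G univ v + 1 : ℕ) : ℝ) ≤ (#(univ : Finset V) : ℝ) := by exact_mod_cast this
    rw [card_univ, hn] at h2
    push_cast at h2
    simp only [hd]
    linarith
  have hs2 : s ≤ d u * (n - 1) := by
    simp only [hd]
    rw [hs, cast_degIn, sum_mul]
    refine sum_le_sum fun v _ => ?_
    split_ifs
    · simpa using hdn v
    · simp
  have hsd : r - d u ≤ n - 1 := by
    have : (r - d u) * d u ≤ (n - 1) * d u := by linarith
    exact le_of_mul_le_mul_right this hdu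
  -- A concave function of `d u`, equal to the left side at both ends of `n - 2k ≤ d u ≤ n - 1`;
  -- integrality gives the lower end.
  have hmain : (n - 1) * (n - 2 * k) ≤ d u * (2 * n - 2 * k - 1 - d u) := by
    have h1 : (n : ℝ) < d u + 2 * k + 1 := by linarith
    simp only [hd] at h1
    have h2 : n ≤ degIn G univ u + 2 * k := by
      have : n < degIn G univ u + 2 * k + 1 := by exact_mod_cast h1
      omega
    have h3 : (n : ℝ) ≤ d u + 2 * k := by
      simp only [hd]
      exact_mod_cast h2
    nlinarith [mul_nonneg (sub_nonneg.2 h3) (sub_nonneg.2 (hdn u))]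
  have : d u * (2 * n - 2 * k - 1 - d u) < (∑ v, degIn G univ v : ℕ) := by
    nlinarith [mul_pos hdu (sub_pos.2 hr)]
  push_cast at this ⊢
  linarith

/-! ### The extremal graph and the comparison with it -/

/-- The graph in which `S` and its complement are cliques and `h` is adjacent to all vertices. -/
def cliquePair (S : Finset V) (h : V) : SimpleGraph V where
  Adj u v := u ≠ v ∧ ((u ∈ S ↔ v ∈ S) ∨ u = h ∨ v = h)
  symm := ⟨fun u v huv => ⟨huv.1.symm, by tauto⟩⟩
  loopless := ⟨fun u hu => hu.1 rfl⟩

theorem nonempty_iso_cliquePair {S : Finset V} {h : V} {n k : ℕ} (hn : Fintype.card V = n)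
    (hS : #S = n - k) (hk : k ≤ n) (hh : h ∈ S) : Nonempty (cliquePair S h ≃g L n k) := by
  classical
  have hS1 : Fintype.card (S.erase h : Finset V) = n - k - 1 := by
    rw [Fintype.card_coe, card_erase_of_mem hh, hS]
  have hS2 : Fintype.card (Sᶜ : Finset V) = k := by
    rw [Fintype.card_coe, card_compl, hn, hS]
    omega
  have hpos : 0 < #S := card_pos.2 ⟨h, hh⟩
  let a := (Fintype.equivFinOfCardEq hS1).symm
  let b := (Fintype.equivFinOfCardEq hS2).symm
  let F : Fin 1 ⊕ (Fin (n - k - 1) ⊕ Fin k) → V :=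
    Sum.elim (fun _ => h) (Sum.elim (fun i => a i) (fun i => b i))
  have ha : ∀ i, (a i : V) ≠ h ∧ (a i : V) ∈ S := fun i => mem_erase.1 (a i).2
  have hb : ∀ i, (b i : V) ∉ S := fun i => mem_compl.1 (b i).2
  have hab : ∀ i j, (a i : V) ≠ b j := fun i j hij => hb j (hij ▸ (ha i).2)
  have hbh : ∀ i, (b i : V) ≠ h := fun i hi => hb i (hi ▸ hh)
  have hinj : Function.Injective F := by
    rintro (i | i | i) (j | j | j) hij <;> simp only [F, Sum.elim_inl, Sum.elim_inr] at hij
    · rw [Subsingleton.elim i j]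
    · exact absurd hij.symm (ha j).1
    · exact absurd hij.symm (hbh j)
    · exact absurd hij (ha i).1
    · rw [a.injective (Subtype.ext hij)]
    · exact absurd hij (hab i j)
    · exact absurd hij (hbh i)
    · exact absurd hij.symm (hab j i)
    · rw [b.injective (Subtype.ext hij)]
  have hbij : Function.Bijective F := by
    rw [Fintype.bijective_iff_injective_and_card]
    refine ⟨hinj, ?_⟩
    simp only [Fintype.card_sum, Fintype.card_fin, hn]
    omega
  refine ⟨(RelIso.symm ⟨Equiv.ofBijective F hbij, ?_⟩)⟩
  rintro (i | i | i) (j | j | j) <;>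
    simp [F, cliquePair, L, join, SimpleGraph.completeGraph, ha, hb, hab, hbh, hh, Subtype.ext_iff.symm,
      (hab _ _).symm, ((ha _).1).symm, (hbh _).symm]
  exact Subsingleton.elim i j

end
end SpectralCycles

namespace SpectralCycles

open Finset Matrix

section
variable {V : Type*} [Fintype V]

/-- The weight of an edge increases with the entries at its ends, so the at most one edge from an
outside vertex into `S` weighs no more than the one to `h`. -/
theorem weightedMatrix_form_le_cliquePair {G : SimpleGraph V} {S : Finset V} {h : V} {t : ℝ}
    (ht : 0 ≤ t) (hh : h ∈ S) (hdeg : ∀ w ∉ S, degIn G S w ≤ 1) {x : V → ℝ} (hx : ∀ v, 0 ≤ x v)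
    (hmax : ∀ v ∈ S, x v ≤ x h) :
    x ⬝ᵥ weightedMatrix t G *ᵥ x ≤ x ⬝ᵥ weightedMatrix t (cliquePair S h) *ᵥ x := by
  classical
  rw [dotProduct_weightedMatrix_mulVec, dotProduct_weightedMatrix_mulVec]
  set φ : V → V → ℝ := fun u v => x u * x v + t * (x u ^ 2 + x v ^ 2) / 2 with hφ
  have hφ0 : ∀ u v, 0 ≤ φ u v := fun u v => by
    have := hx u
    have := hx v
    simp only [hφ]
    positivity
  have hφc : ∀ u v, φ u v = φ v u := fun u v => by simp only [hφ]; ring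
  have split : ∀ H : SimpleGraph V, (∑ u, ∑ v, if H.Adj u v then φ u v else 0) =
      (∑ u ∈ S, ∑ v ∈ S, if H.Adj u v then φ u v else 0) +
      2 * (∑ u ∈ Sᶜ, ∑ v ∈ S, if H.Adj u v then φ u v else 0) +
      (∑ u ∈ Sᶜ, ∑ v ∈ Sᶜ, if H.Adj u v then φ u v else 0) := by
    intro H
    have h1 : (∑ u ∈ S, ∑ v ∈ Sᶜ, if H.Adj u v then φ u v else 0) =
        ∑ u ∈ Sᶜ, ∑ v ∈ S, if H.Adj u v then φ u v else 0 := by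
      rw [sum_comm]
      refine sum_congr rfl fun u _ => sum_congr rfl fun v _ => ?_
      rw [hφc]
      simp only [H.adj_comm]
    rw [← sum_add_sum_compl S]
    simp only [← sum_add_sum_compl S (fun v => if H.Adj _ v then φ _ v else 0)]
    rw [sum_add_distrib, sum_add_distrib, h1]
    ring
  have mono : ∀ u v, (G.Adj u v → (cliquePair S h).Adj u v) →
      (if G.Adj u v then φ u v else 0) ≤ if (cliquePair S h).Adj u v then φ u v else 0 := by
    intro u v himp
    split_ifs with c1 c2 c2
    · exact le_rfl
    · exact absurd (himp c1) c2
    · exact hφ0 u v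
    · exact le_rfl
  change (∑ u, ∑ v, if G.Adj u v then φ u v else 0) ≤
    ∑ u, ∑ v, if (cliquePair S h).Adj u v then φ u v else 0
  rw [split, split]
  have hcross : (∑ u ∈ Sᶜ, ∑ v ∈ S, if G.Adj u v then φ u v else 0) ≤
      ∑ u ∈ Sᶜ, ∑ v ∈ S, if (cliquePair S h).Adj u v then φ u v else 0 := by
    refine sum_le_sum fun u hu => ?_
    rw [mem_compl] at hu
    calc (∑ v ∈ S, if G.Adj u v then φ u v else 0)
        ≤ ∑ v ∈ S, (if G.Adj u v then 1 else 0) * φ u h := by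
          refine sum_le_sum fun v hv => ?_
          split_ifs
          · rw [one_mul]
            have h1 := hmax v hv
            have h2 := hx u
            have h3 := hx v
            simp only [hφ]
            gcongr
          · simp
      _ = degIn G S u * φ u h := by rw [cast_degIn, sum_mul]
      _ ≤ 1 * φ u h :=
          mul_le_mul_of_nonneg_right (by exact_mod_cast hdeg u hu) (hφ0 u h)
      _ = if (cliquePair S h).Adj u h then φ u h else 0 := by
          rw [if_pos, one_mul]
          exact ⟨fun e => hu (e ▸ hh), Or.inr (Or.inr rfl)⟩
      _ ≤ ∑ v ∈ S, if (cliquePair S h).Adj u v then φ u v else 0 := by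
          refine single_le_sum (f := fun v => if (cliquePair S h).Adj u v then φ u v else 0)
            (fun v _ => ?_) hh
          split_ifs
          · exact hφ0 u v
          · exact le_rfl
  have hin : (∑ u ∈ S, ∑ v ∈ S, if G.Adj u v then φ u v else 0) ≤
      ∑ u ∈ S, ∑ v ∈ S, if (cliquePair S h).Adj u v then φ u v else 0 :=
    sum_le_sum fun u hu => sum_le_sum fun v hv =>
      mono u v fun huv => ⟨huv.ne, Or.inl (iff_of_true hu hv)⟩
  have hout : (∑ u ∈ Sᶜ, ∑ v ∈ Sᶜ, if G.Adj u v then φ u v else 0) ≤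
      ∑ u ∈ Sᶜ, ∑ v ∈ Sᶜ, if (cliquePair S h).Adj u v then φ u v else 0 :=
    sum_le_sum fun u hu => sum_le_sum fun v hv =>
      mono u v fun huv => ⟨huv.ne, Or.inl (iff_of_false (mem_compl.1 hu) (mem_compl.1 hv))⟩
  linarith

/-- Among graphs in which every vertex outside `S` has at most one neighbour in `S`, the graphs
`cliquePair S h` are the only ones of maximal weighted spectral radius. -/
theorem eq_cliquePair_of_weightedRadius_le {G : SimpleGraph V} {S : Finset V} {t : ℝ}
    (ht : 0 ≤ t) (hS : S.Nonempty) (hdeg : ∀ w ∉ S, degIn G S w ≤ 1)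
    (hle : ∀ h ∈ S, weightedRadius t (cliquePair S h) ≤ weightedRadius t G) :
    ∃ h ∈ S, G = cliquePair S h := by
  classical
  have : Nonempty V := ⟨hS.choose⟩
  obtain ⟨x, hx, hx0, hxG⟩ := exists_nonneg_weightedMatrix_eigenvector ht G
  obtain ⟨h, hh, hmax⟩ := exists_max_image S x hS
  refine ⟨h, hh, ?_⟩
  set H := cliquePair S h with hH
  have hform := weightedMatrix_form_le_cliquePair ht hh hdeg hx0 hmax
  have hxx : 0 < x ⬝ᵥ x := by
    refine lt_of_le_of_ne (sum_nonneg fun v _ => mul_self_nonneg _) fun e => hx ?_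
    exact dotProduct_self_eq_zero.1 e.symm
  have hGx : x ⬝ᵥ weightedMatrix t G *ᵥ x = weightedRadius t G * (x ⬝ᵥ x) := by
    rw [hxG, dotProduct_smul, smul_eq_mul]
  have hHx : x ⬝ᵥ weightedMatrix t H *ᵥ x ≤ weightedRadius t H * (x ⬝ᵥ x) :=
    dotProduct_mulVec_le_largestEigenvalue (isHermitian_weightedMatrix t H) x
  have hlam : weightedRadius t H = weightedRadius t G := by
    refine le_antisymm (hle h hh) ?_
    have : weightedRadius t G * (x ⬝ᵥ x) ≤ weightedRadius t H * (x ⬝ᵥ x) := by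
      rw [← hGx]
      exact hform.trans hHx
    exact le_of_mul_le_mul_right this hxx
  have hxH : weightedMatrix t H *ᵥ x = weightedRadius t H • x := by
    refine mulVec_eq_of_dotProduct_mulVec_eq (isHermitian_weightedMatrix t H) ?_
    change weightedRadius t H * (x ⬝ᵥ x) ≤ _
    rw [hlam, ← hGx]
    exact hform
  have hrowH : ∀ u, (∑ v, if H.Adj u v then x v + t * x u else 0) = weightedRadius t H * x u := by
    intro u
    rw [← weightedMatrix_mulVec, hxH, Pi.smul_apply, smul_eq_mul]
  have hrowG : ∀ u, (∑ v, if G.Adj u v then x v + t * x u else 0) = weightedRadius t H * x u := by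
    intro u
    rw [← weightedMatrix_mulVec, hxG, hlam, Pi.smul_apply, smul_eq_mul]
  have hterm0 : ∀ (u v : V), 0 ≤ x v + t * x u := fun u v =>
    add_nonneg (hx0 v) (mul_nonneg ht (hx0 u))
  have hadjh : ∀ v, v ≠ h → H.Adj h v := fun v hv => ⟨hv.symm, Or.inr (Or.inl rfl)⟩
  -- Zeros spread along edges of `H`, where `h` is adjacent to everything; hence `x` is positive.
  have hzero : ∀ u v, x u = 0 → H.Adj u v → x v = 0 := by
    intro u v hu huv
    refine le_antisymm ?_ (hx0 v)
    calc x v = if H.Adj u v then x v + t * x u else 0 := by rw [if_pos huv, hu, mul_zero, add_zero]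
      _ ≤ ∑ w, if H.Adj u w then x w + t * x u else 0 := by
        refine single_le_sum (f := fun w => if H.Adj u w then x w + t * x u else 0)
          (fun w _ => ?_) (mem_univ v)
        split_ifs
        · exact hterm0 u w
        · exact le_rfl
      _ = 0 := by rw [hrowH, hu, mul_zero]
  have hxh : x h ≠ 0 := by
    refine fun e => hx (funext fun v => ?_)
    by_cases hv : v = h
    · rw [hv, e]
      rfl
    · exact hzero h v e (hadjh v hv)
  have hpos : ∀ u, 0 < x u := by
    intro u
    refine lt_of_le_of_ne (hx0 u) fun e => hxh ?_
    by_cases hu : u = h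
    · rw [← hu, ← e]
    · exact hzero u h e.symm (hadjh u hu).symm
  -- The rows of `G` and `H` at `u` have the same value at the positive vector `x`, so nested
  -- neighbourhoods coincide. Used first at `h`: this makes `h` the only possible neighbour in `S`
  -- of an outside vertex, and so puts `G` inside `H`.
  have key : ∀ u, (∀ v, G.Adj u v → H.Adj u v) → ∀ v, H.Adj u v → G.Adj u v := by
    intro u hu v hv
    by_contra hn
    have : (∑ v, if G.Adj u v then x v + t * x u else 0) <
        ∑ v, if H.Adj u v then x v + t * x u else 0 := by
      refine sum_lt_sum (fun w _ => ?_) ⟨v, mem_univ v, ?_⟩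
      · split_ifs with c1 c2 c2
        · exact le_rfl
        · exact absurd (hu w c1) c2
        · exact hterm0 u w
        · exact le_rfl
      · rw [if_neg hn, if_pos hv]
        have := hpos v
        have := hpos u
        positivity
    rw [hrowG, hrowH] at this
    exact lt_irrefl _ this
  have hall : ∀ v, v ≠ h → G.Adj h v := fun v hv =>
    key h (fun w hw => hadjh w hw.ne') v (hadjh v hv)
  have hcross : ∀ u ∉ S, ∀ v ∈ S, G.Adj u v → v = h := by
    intro u hu v hv huv
    have := card_le_one.1 (hdeg u hu)
    refine this v (by simp [hv, huv]) h ?_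
    simp only [mem_filter]
    exact ⟨hh, (hall u fun e => hu (e ▸ hh)).symm⟩
  have hsub : ∀ u v, G.Adj u v → H.Adj u v := by
    intro u v huv
    refine ⟨huv.ne, ?_⟩
    by_cases hu : u ∈ S <;> by_cases hv : v ∈ S
    · exact Or.inl (iff_of_true hu hv)
    · exact Or.inr (Or.inl (hcross v hv u hu huv.symm))
    · exact Or.inr (Or.inr (hcross u hu v hv huv))
    · exact Or.inl (iff_of_false hu hv)
  ext u v
  exact ⟨hsub u v, key u (hsub u) v⟩

theorem even_sum_degIn (G : SimpleGraph V) : Even (∑ v, degIn G univ v) := by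
  classical
  have h : ∀ v, degIn G univ v = G.degree v := by
    intro v
    rw [← SimpleGraph.card_neighborFinset_eq_degree, SimpleGraph.neighborFinset_eq_filter, degIn]
  simp only [h, SimpleGraph.sum_degrees_eq_twice_card_edges]
  exact even_two_mul _

/-- A lower bound for the weighted spectral radius of `L n k`. -/
theorem le_weightedRadius_L {t : ℝ} (ht : 0 ≤ t) {n k : ℕ} (hk : 1 ≤ k) (hkn : k + 1 ≤ n) :
    (1 + t) * (n - k - 1) * (n - k) + t ≤ weightedRadius t (L n k) * (n - k : ℝ) := by
  have h1 : n - k ≤ #(univ : Finset (Fin n)) := by simp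
  obtain ⟨S, -, hS⟩ := exists_subset_card_eq h1
  have hSpos : 0 < #S := by omega
  obtain ⟨h, hh⟩ := card_pos.1 hSpos
  obtain ⟨w, hw⟩ : ∃ w, w ∉ S := by
    by_contra! hall
    rw [eq_univ_of_forall hall, card_univ, Fintype.card_fin] at hS
    omega
  obtain ⟨e⟩ := nonempty_iso_cliquePair (Fintype.card_fin n) hS (by omega) hh
  have := le_weightedRadius_of_isClique (G := cliquePair S h) ht
    (fun u hu v hv huv => ⟨huv, Or.inl (iff_of_true hu hv)⟩) hh hw
    ⟨fun e => hw (e ▸ hh), Or.inr (Or.inl rfl)⟩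
  rw [weightedRadius_congr e, hS, Nat.cast_sub (by omega)] at this
  exact this

/-! ### Assembly of the two cases -/

theorem contains_cycles_or_iso_of_dense {G : SimpleGraph V} {n k a : ℕ} (hk : 1 ≤ k)
    (hn : Fintype.card V = n) (ha : a + k = n) (h1 : 5 * k + 11 ≤ a)
    (h2 : k ^ 2 + 5 * k + 12 ≤ 2 * a)
    (hD : a ^ 2 + (k + 2) * (k + 1) + 6 ≤ ∑ v, degIn G univ v + 3 * a) {t : ℝ} (ht : 0 ≤ t)
    (hle : weightedRadius t (L n k) ≤ weightedRadius t G) :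
    (∀ ℓ : ℕ, 3 ≤ ℓ → ℓ ≤ n - k + 1 → (SimpleGraph.cycleGraph ℓ).IsContained G) ∨
      Nonempty (G ≃g L n k) := by
  by_contra hcon
  push Not at hcon
  obtain ⟨⟨l, hl, hl', hcyc⟩, hiso⟩ := hcon
  obtain ⟨S, hS, hdeg⟩ := exists_subset_degIn_le_one hk (hn.trans ha.symm) h1 h2 hD hl
    (by omega) (not_nonempty_iff.2 hcyc)
  have hSn : #S = n - k := by omega
  obtain ⟨h, hh, hG⟩ := eq_cliquePair_of_weightedRadius_le ht (card_pos.1 (by omega)) hdeg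
    (fun h hh => by
      obtain ⟨e⟩ := nonempty_iso_cliquePair hn hSn (by omega) hh
      rwa [weightedRadius_congr e])
  obtain ⟨e⟩ := nonempty_iso_cliquePair hn hSn (by omega) hh
  rw [← hG] at e
  exact hiso.false e

end

end SpectralCycles

theorem mainTheorem2 {V : Type*} [Fintype V] (n k : ℕ) (hk : 1 ≤ k)
    (G : SimpleGraph V) (hn : Fintype.card V = n)
    (h : (SpectralCycles.rho (SpectralCycles.L n k) ≤ SpectralCycles.rho G ∧
            max (6 * k + 11) ((k + 3) * (k + 4) / 2) ≤ n) ∨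
         (SpectralCycles.q (SpectralCycles.L n k) ≤ SpectralCycles.q G ∧
            max (6 * k + 11) (k ^ 2 + 2 * k + 3) ≤ n)) :
    (∀ ℓ : ℕ, 3 ≤ ℓ → ℓ ≤ n - k + 1 → (SimpleGraph.cycleGraph ℓ).IsContained G) ∨
      Nonempty (G ≃g SpectralCycles.L n k) := by
  have h6 : 6 * k + 11 ≤ n := by
    rcases h with ⟨-, h⟩ | ⟨-, h⟩ <;> exact (le_max_left _ _).trans h
  obtain ⟨a, ha⟩ : ∃ a, a + k = n := ⟨n - k, by omega⟩
  have hV : Nonempty V := Fintype.card_pos_iff.1 (by omega)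
  have haR : (n : ℝ) = a + k := by exact_mod_cast ha.symm
  have ha0 : (0 : ℝ) < a := by
    have : 0 < a := by omega
    exact_mod_cast this
  rcases h with ⟨hr, hmax⟩ | ⟨hr, hmax⟩
  · have hmax := (le_max_right _ _).trans hmax
    -- The product of consecutive integers is even, so the floor in the hypothesis loses nothing.
    have h2 : k ^ 2 + 5 * k + 12 ≤ 2 * a := by
      have : (k + 3) * (k + 4) ≤ 2 * n + 1 := by omega
      have hev : Even ((k + 3) * (k + 4)) := Nat.even_mul_succ_self (k + 3)
      obtain ⟨c, hc⟩ := hev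
      have : (k + 3) * (k + 4) ≤ 2 * n := by omega
      nlinarith
    rw [SpectralCycles.rho_eq_weightedRadius, SpectralCycles.rho_eq_weightedRadius] at hr
    have hL := SpectralCycles.le_weightedRadius_L le_rfl hk (n := n) (by omega)
    rw [haR] at hL
    have hr1 : (a : ℝ) - 1 ≤ SpectralCycles.weightedRadius 0 (SpectralCycles.L n k) :=
      le_of_mul_le_mul_right (by linarith) ha0
    have hS := SpectralCycles.weightedRadius_zero_mul_le G
    have hD : (a : ℝ) ^ 2 ≤ (∑ v, SpectralCycles.degIn G Finset.univ v : ℕ) + a := by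
      have ha1 : (1 : ℝ) ≤ a := by exact_mod_cast (by omega : 1 ≤ a)
      nlinarith
    have hD' : a ^ 2 ≤ ∑ v, SpectralCycles.degIn G Finset.univ v + a := by exact_mod_cast hD
    exact SpectralCycles.contains_cycles_or_iso_of_dense hk hn ha (by omega) h2 (by nlinarith)
      le_rfl hr
  · have hmax := (le_max_right _ _).trans hmax
    rw [SpectralCycles.q_eq_weightedRadius, SpectralCycles.q_eq_weightedRadius] at hr
    have hL := SpectralCycles.le_weightedRadius_L zero_le_one hk (n := n) (by omega)
    rw [haR] at hL
    -- Strict because of the extra `t = 1` from the edge leaving the clique.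
    have hr1 : 2 * ((n : ℝ) - k - 1) < SpectralCycles.weightedRadius 1 (SpectralCycles.L n k) := by
      refine lt_of_mul_lt_mul_right ?_ ha0.le
      rw [haR]
      linarith
    have hS := SpectralCycles.lt_sum_degIn_of_lt_weightedRadius_one hn (by omega)
      (hr1.trans_le hr)
    rw [haR] at hS
    obtain ⟨c, hc⟩ := SpectralCycles.even_sum_degIn G
    have hD : ((a : ℝ) ^ 2 + k) < (∑ v, SpectralCycles.degIn G Finset.univ v : ℕ) + a + k ^ 2 := by
      linarith
    have hD' : a ^ 2 + k < ∑ v, SpectralCycles.degIn G Finset.univ v + a + k ^ 2 := by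
      exact_mod_cast hD
    -- By parity the strict inequality `hD'` has a gap of at least 2, just enough when `n = k² + 2k
    -- + 3`.
    obtain ⟨c1, hc1⟩ := Nat.even_mul_succ_self k
    obtain ⟨c2, hc2⟩ := Nat.even_mul_succ_self a
    have hD2 : a ^ 2 + k + 2 ≤ ∑ v, SpectralCycles.degIn G Finset.univ v + a + k ^ 2 := by
      have e1 : k * (k + 1) = k ^ 2 + k := by ring
      have e2 : a * (a + 1) = a ^ 2 + a := by ring
      omega
    exact SpectralCycles.contains_cycles_or_iso_of_dense hk hn ha (by omega) (by nlinarith)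
      (by nlinarith) zero_le_one hr
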